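/- Let $s(n,j)$, for integers $n\ge j\ge 0$, denote the (signed) Stirling numbers of the first kind, generated by $$\frac{[\ln(1+x)]^j}{j!}=\sum_{n=j}^\infty s(n,j)\frac{x^n}{n!},\qquad |x|<1,$$ and for integers $k\ge 1$ and $m\ge 2$ put $$Q(k,m)=\sum_{\ell=0}^{m}\binom{k+\ell-1}{k-1}\,s(k+m-1,\,k+\ell-1)\left(\frac{k+m-2}{2}\right)^{\ell}.$$ Then for every integer $k\ge 1$ the following series converges and $$\left(\frac{\pi^2}{8}\right)^k=1+(2k)!\sum_{m=1}^{\infty}(-1)^m 2^m\,\frac{Q(2k,2m)}{(2k+2m)!}.$$ In particular, also with a convergent series, $$\frac{\pi^2}{8}=\sum_{m=1}^{\infty}\frac{2^m}{m^2}\,\frac{1}{\binom{2m}{m}}.$$ -/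

import Mathlib

/-- The signed Stirling number of the first kind `s(n, k)`, that is `(-1) ^ (n - k)` times the
unsigned one (the exponent `n + k` has the parity of `n - k`); equivalently
`log (1 + x) ^ k / k! = ∑_{n ≥ k} s(n, k) x ^ n / n!` for `|x| < 1`. -/
def signedStirlingFirst (n k : ℕ) : ℤ :=
  (-1) ^ (n + k) * (Nat.stirlingFirst n k : ℤ)

/-- `Q(k, m) = ∑_{ℓ = 0}^{m} C(k + ℓ - 1, k - 1) s(k + m - 1, k + ℓ - 1) ((k + m - 2) / 2) ^ ℓ`,
used for `k ≥ 1` and `m ≥ 2`, where no subtraction of natural numbers truncates. -/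
noncomputable def stirlingQ (k m : ℕ) : ℝ :=
  ∑ l ∈ Finset.range (m + 1),
    (Nat.choose (k + l - 1) (k - 1) : ℝ) * (signedStirlingFirst (k + m - 1) (k + l - 1) : ℝ) *
      (((k : ℝ) + (m : ℝ) - 2) / 2) ^ l

/-!
Both series are the values at `θ = π / 4`, where `(2 sin θ) ^ 2 = 2`, of an expansion of
`(2 θ) ^ (2 k) / (2 k)!` in the divided powers `(2 sin θ) ^ (2 n) / (2 n)!`. Its coefficients are
central factorial numbers: expanding the falling factorial `x (x - 1) ⋯ (x - 2 n)` around its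
middle root `n` gives `x (x ^ 2 - 1 ^ 2) ⋯ (x ^ 2 - n ^ 2)`, which identifies `Q(2 k, 2 m)` up to
sign with such a number.

The recursion of the central factorial numbers matches the formula for the second derivative of
the divided powers of `2 sin θ`, so the second derivative of the remainder for the exponent
`2 k + 2` is four times the sum of the remainder for the exponent `2 k` and a boundary term. By
induction on `k` the remainders are nonnegative for `θ ≥ 0`, which at `θ = π / 2` bounds the
central factorial numbers. This bound makes the boundary terms, and then, again by induction on
`k`, the remainders tend to zero uniformly on compact subsets of `(-π / 2, π / 2)`.
-/

/-- The unsigned central factorial numbers of the first kind, with even indices `(2 n, 2 k)`: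
`centralFactorialFirst n k` is the coefficient of `x ^ k` in `∏ j < n, (x + j ^ 2)`. As with
`Nat.stirlingFirst`, the recursion is taken as the definition. -/
def centralFactorialFirst : ℕ → ℕ → ℕ
  | 0, 0 => 1
  | 0, _ + 1 => 0
  | _ + 1, 0 => 0
  | n + 1, k + 1 => n ^ 2 * centralFactorialFirst n (k + 1) + centralFactorialFirst n k

theorem centralFactorialFirst_zero_zero : centralFactorialFirst 0 0 = 1 := by
  rw [centralFactorialFirst]

theorem centralFactorialFirst_zero_succ (k : ℕ) : centralFactorialFirst 0 (k + 1) = 0 := by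
  rw [centralFactorialFirst]

theorem centralFactorialFirst_succ_zero (n : ℕ) : centralFactorialFirst (n + 1) 0 = 0 := by
  rw [centralFactorialFirst]

theorem centralFactorialFirst_succ_succ (n k : ℕ) :
    centralFactorialFirst (n + 1) (k + 1) =
      n ^ 2 * centralFactorialFirst n (k + 1) + centralFactorialFirst n k := by
  rw [centralFactorialFirst]

theorem centralFactorialFirst_eq_zero_of_lt {n k : ℕ} (h : n < k) :
    centralFactorialFirst n k = 0 := by
  induction n generalizing k with
  | zero =>
    obtain ⟨k, rfl⟩ := Nat.exists_eq_add_one_of_ne_zero h.ne'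
    exact centralFactorialFirst_zero_succ k
  | succ n ih =>
    obtain ⟨k, rfl⟩ := Nat.exists_eq_add_one_of_ne_zero (Nat.ne_zero_of_lt h)
    rw [centralFactorialFirst_succ_succ, ih (by lia), ih (by lia), mul_zero]

theorem centralFactorialFirst_self (n : ℕ) : centralFactorialFirst n n = 1 := by
  induction n with
  | zero => exact centralFactorialFirst_zero_zero
  | succ n ih =>
    rw [centralFactorialFirst_succ_succ, ih, centralFactorialFirst_eq_zero_of_lt n.lt_succ_self,
      mul_zero]

theorem centralFactorialFirst_succ_one (n : ℕ) :
    centralFactorialFirst (n + 1) 1 = n.factorial ^ 2 := by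
  induction n with
  | zero => exact centralFactorialFirst_self 1
  | succ n ih =>
    rw [centralFactorialFirst_succ_succ, zero_add, ih, centralFactorialFirst_succ_zero,
      Nat.factorial_succ, add_zero, mul_pow]

theorem sum_centralFactorialFirst_succ_mul {R : Type*} [CommRing R] (s : ℕ → R) (k N : ℕ) :
    ∑ n ∈ Finset.range N,
        (centralFactorialFirst (n + 1) (k + 1) : R) * (s n - ((n : R) + 1) ^ 2 * s (n + 1)) =
      ∑ n ∈ Finset.range N, (centralFactorialFirst n k : R) * s n -
        (N : R) ^ 2 * ((centralFactorialFirst N (k + 1) : R) * s N) := by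
  induction N with
  | zero => simp
  | succ N ih =>
    rw [Finset.sum_range_succ, ih, Finset.sum_range_succ, centralFactorialFirst_succ_succ]
    push_cast
    ring

section TaylorCoefficients

open Polynomial

theorem coeff_descPochhammer {R : Type*} [Ring R] (n i : ℕ) :
    (descPochhammer R n).coeff i = (signedStirlingFirst n i : R) := by
  induction n generalizing i with
  | zero => cases i <;> simp [signedStirlingFirst, coeff_one]
  | succ n ih =>
    rw [descPochhammer_succ_right, mul_sub, coeff_sub, ← C_eq_natCast, coeff_mul_C, ih]
    cases i with
    | zero => cases n <;> simp [signedStirlingFirst]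
    | succ i =>
      have hrec : signedStirlingFirst (n + 1) (i + 1) =
          signedStirlingFirst n i - signedStirlingFirst n (i + 1) * n := by
        simp only [signedStirlingFirst, Nat.stirlingFirst_succ_succ]
        push_cast
        ring
      rw [coeff_mul_X, ih, hrec]
      push_cast
      rfl

theorem coeff_taylor_eq_sum {R : Type*} [Semiring R] {p : R[X]} {a b : ℕ}
    (hp : p.natDegree ≤ a + b) (x : R) :
    (taylor x p).coeff a =
      ∑ l ∈ Finset.range (b + 1), ((a + l).choose a : R) * p.coeff (a + l) * x ^ l := by
  rw [taylor_coeff, hasseDeriv_apply, sum_over_range' _ (by simp) (a + (b + 1)) (by lia),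
    eval_finsetSum, Finset.sum_range_add, Finset.sum_eq_zero, zero_add]
  · simp only [eval_monomial, Nat.add_sub_cancel_left]
  · intro i hi
    simp [Nat.choose_eq_zero_of_lt (Finset.mem_range.mp hi)]

theorem stirlingQ_succ_eq_coeff_taylor (k m : ℕ) :
    stirlingQ (k + 1) m =
      (taylor (((k : ℝ) + m - 1) / 2) (descPochhammer ℝ (k + m))).coeff k := by
  rw [coeff_taylor_eq_sum (descPochhammer_natDegree ..).le, stirlingQ]
  refine Finset.sum_congr rfl fun l _ => ?_
  rw [coeff_descPochhammer, add_right_comm k 1 l, add_right_comm k 1 m]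
  simp only [Nat.add_sub_cancel]
  push_cast
  ring_nf

theorem taylor_descPochhammer_mul_X {R : Type*} [CommRing R] (n : ℕ) :
    taylor (n : R) (descPochhammer R (2 * n + 1)) * X =
      ∏ j ∈ Finset.range (n + 1), (X ^ 2 - C ((j : R) ^ 2)) := by
  induction n with
  | zero => simp [sq]
  | succ n ih =>
    have hstep : descPochhammer R (2 * (n + 1) + 1) =
        X * taylor (-1) (descPochhammer R (2 * n + 1)) * (X - C (2 * (n : R) + 2)) := by
      rw [show 2 * (n + 1) + 1 = (2 * n + 1 + 1) + 1 by ring, descPochhammer_succ_right,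
        descPochhammer_succ_left, taylor_apply]
      simp only [map_neg, map_one, map_add, map_mul, map_natCast, map_ofNat,
        Nat.cast_add, Nat.cast_mul, Nat.cast_ofNat, sub_eq_add_neg]
    rw [Finset.prod_range_succ, ← ih, hstep, taylor_mul, taylor_mul, taylor_taylor,
      show ((n + 1 : ℕ) : R) + -1 = n by push_cast; ring]
    simp only [map_sub, taylor_X, taylor_C]
    simp only [map_add, map_mul, map_pow, map_natCast, map_one, map_ofNat, Nat.cast_add,
      Nat.cast_one]
    ring

theorem coeff_prod_X_sq_sub_sq {R : Type*} [CommRing R] (n k : ℕ) :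
    (∏ j ∈ Finset.range n, (X ^ 2 - C ((j : R) ^ 2))).coeff (2 * k) =
      (-1) ^ (n + k) * (centralFactorialFirst n k : R) := by
  induction n generalizing k with
  | zero => cases k <;> simp [centralFactorialFirst, coeff_one]
  | succ n ih =>
    rw [Finset.prod_range_succ, mul_sub, coeff_sub, coeff_mul_C, ih]
    cases k with
    | zero => cases n <;> simp [centralFactorialFirst]
    | succ k =>
      rw [mul_add_one, coeff_mul_X_pow, ih, centralFactorialFirst_succ_succ]
      push_cast
      ring

theorem stirlingQ_two_mul {k : ℕ} (hk : k ≠ 0) (m : ℕ) :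
    stirlingQ (2 * k) (2 * m) = (-1) ^ m * (centralFactorialFirst (k + m) k : ℝ) := by
  obtain ⟨k, rfl⟩ := Nat.exists_eq_add_one_of_ne_zero hk
  have hcentre : (((2 * k + 1 : ℕ) : ℝ) + (2 * m : ℕ) - 1) / 2 = (k + m : ℕ) := by
    push_cast
    ring
  have hsign : (-1 : ℝ) ^ (k + m + 1 + (k + 1)) = (-1) ^ m := by
    rw [show k + m + 1 + (k + 1) = m + 2 * (k + 1) by ring, pow_add, pow_mul, neg_one_sq,
      one_pow, mul_one]
  rw [mul_add_one, stirlingQ_succ_eq_coeff_taylor, hcentre,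
    show 2 * k + 1 + 2 * m = 2 * (k + m) + 1 by ring, ← coeff_mul_X,
    taylor_descPochhammer_mul_X, show 2 * k + 1 + 1 = 2 * (k + 1) by ring, coeff_prod_X_sq_sub_sq,
    hsign, add_right_comm k m 1]

end TaylorCoefficients

section Calculus

open Filter

theorem nonneg_of_hasDerivAt_nonneg {f f' : ℝ → ℝ} {a : ℝ} (hf : ∀ x, HasDerivAt f (f' x) x)
    (ha : 0 ≤ f a) (hf' : ∀ x, a ≤ x → 0 ≤ f' x) {x : ℝ} (hx : a ≤ x) : 0 ≤ f x := by
  have hmono : MonotoneOn f (Set.Ici a) :=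
    monotoneOn_of_hasDerivWithinAt_nonneg (convex_Ici a)
      (fun y _ => (hf y).continuousAt.continuousWithinAt) (fun y _ => (hf y).hasDerivWithinAt)
      fun y hy => hf' y (interior_subset hy)
  exact ha.trans (hmono Set.self_mem_Ici hx hx)

theorem tendstoUniformlyOn_zero_of_hasDerivWithinAt {ι 𝕜 E : Type*} [RCLike 𝕜]
    [NormedAddCommGroup E] [NormedSpace 𝕜 E] {l : Filter ι} {f f' : ι → 𝕜 → E} {s : Set 𝕜} {a : 𝕜}
    (hs : Convex ℝ s) (hbdd : Bornology.IsBounded s) (has : a ∈ s)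
    (hf : ∀ i, ∀ x ∈ s, HasDerivWithinAt (f i) (f' i x) s x) (ha : ∀ i, f i a = 0)
    (hf' : TendstoUniformlyOn f' 0 l s) : TendstoUniformlyOn f 0 l s := by
  obtain ⟨D, hD, hsD⟩ := hbdd.exists_pos_norm_le
  rw [SeminormedAddGroup.tendstoUniformlyOn_zero] at hf' ⊢
  intro ε hε
  filter_upwards [hf' (ε / (4 * D)) (by positivity)] with i hi x hx
  have hdist : ‖x - a‖ ≤ 2 * D := by linarith [norm_sub_le x a, hsD x hx, hsD a has]
  calc ‖f i x‖ = ‖f i x - f i a‖ := by rw [ha, sub_zero]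
    _ ≤ ε / (4 * D) * ‖x - a‖ :=
      hs.norm_image_sub_le_of_norm_hasDerivWithin_le (hf i) (fun y hy => (hi y hy).le) has hx
    _ ≤ ε / (4 * D) * (2 * D) := by gcongr
    _ = ε / 2 := by field_simp; norm_num
    _ < ε := half_lt_self hε

theorem tendstoUniformlyOn_add_atTop_iff_nat {α β : Type*} [UniformSpace β] {F : ℕ → α → β}
    {f : α → β} {s : Set α} (k : ℕ) :
    TendstoUniformlyOn (fun n => F (n + k)) f atTop s ↔ TendstoUniformlyOn F f atTop s := by
  conv_rhs => rw [← map_add_atTop_eq_nat k]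
  rfl

theorem hasDerivAt_pow_succ_div_factorial {𝕜 : Type*} [NontriviallyNormedField 𝕜]
    [CharZero 𝕜] {f : 𝕜 → 𝕜} {f' x : 𝕜} (hf : HasDerivAt f f' x) (n : ℕ) :
    HasDerivAt (fun y => f y ^ (n + 1) / ((n + 1).factorial : 𝕜))
      (f x ^ n / (n.factorial : 𝕜) * f') x := by
  refine ((hf.fun_pow (n + 1)).div_const _).congr_deriv ?_
  have hfac : (n.factorial : 𝕜) ≠ 0 := Nat.cast_ne_zero.mpr n.factorial_ne_zero
  have hsucc : (n : 𝕜) + 1 ≠ 0 := Nat.cast_add_one_ne_zero n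
  rw [Nat.factorial_succ, Nat.add_sub_cancel]
  push_cast
  field_simp

end Calculus

section SinDividedPow

open Real

/-- The divided power `(2 sin θ) ^ n / n!`, the basis in which powers of `θ` are expanded. -/
noncomputable def sinDividedPow (n : ℕ) (θ : ℝ) : ℝ :=
  (2 * sin θ) ^ n / (n.factorial : ℝ)

theorem sinDividedPow_zero (θ : ℝ) : sinDividedPow 0 θ = 1 := by
  simp [sinDividedPow]

theorem sinDividedPow_succ_apply_zero (n : ℕ) : sinDividedPow (n + 1) 0 = 0 := by
  simp [sinDividedPow]

theorem sinDividedPow_two_mul_nonneg (n : ℕ) (θ : ℝ) : 0 ≤ sinDividedPow (2 * n) θ := by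
  rw [sinDividedPow, pow_mul]
  positivity

theorem sinDividedPow_two_mul_eq_mul_pow (n : ℕ) (θ : ℝ) :
    sinDividedPow (2 * n) θ = sinDividedPow (2 * n) (π / 2) * (sin θ ^ 2) ^ n := by
  rw [sinDividedPow, sinDividedPow, sin_pi_div_two, mul_one, mul_pow, pow_mul (sin θ)]
  ring

theorem sin_mul_sinDividedPow (n : ℕ) (θ : ℝ) :
    sin θ * sinDividedPow n θ = (n + 1) / 2 * sinDividedPow (n + 1) θ := by
  rw [sinDividedPow, sinDividedPow, Nat.factorial_succ]
  push_cast
  field_simp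
  ring

theorem hasDerivAt_sinDividedPow_succ (n : ℕ) (θ : ℝ) :
    HasDerivAt (sinDividedPow (n + 1)) (2 * (cos θ * sinDividedPow n θ)) θ := by
  refine (hasDerivAt_pow_succ_div_factorial ((hasDerivAt_sin θ).const_mul 2) n).congr_deriv ?_
  rw [sinDividedPow]
  ring

theorem hasDerivAt_cos_mul_sinDividedPow_succ (n : ℕ) (θ : ℝ) :
    HasDerivAt (fun θ => cos θ * sinDividedPow (n + 1) θ)
      (2 * sinDividedPow n θ - (n + 2) ^ 2 / 2 * sinDividedPow (n + 2) θ) θ := by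
  refine ((hasDerivAt_cos θ).mul (hasDerivAt_sinDividedPow_succ n θ)).congr_deriv ?_
  have h₀ := sin_mul_sinDividedPow n θ
  have h₁ := sin_mul_sinDividedPow (n + 1) θ
  push_cast at h₁
  linear_combination 2 * sinDividedPow n θ * sin_sq_add_cos_sq θ - 2 * sin θ * h₀ -
    (n + 2) * h₁

end SinDividedPow

section SinRemainder

open Real Filter Topology

/-- The error of the `N`-term partial sum in the expansion of `(2 θ) ^ (2 k) / (2 k)!` in the
divided powers of `2 sin θ`. -/
noncomputable def sinRemainder (k N : ℕ) (θ : ℝ) : ℝ :=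
  (2 * θ) ^ (2 * k) / ((2 * k).factorial : ℝ) -
    ∑ n ∈ Finset.range N, (centralFactorialFirst n k : ℝ) * sinDividedPow (2 * n) θ

/-- The derivative of `sinRemainder (k + 1) (N + 1)`; the indices are shifted so that no
subtraction occurs. -/
noncomputable def sinRemainderDeriv (k N : ℕ) (θ : ℝ) : ℝ :=
  2 * ((2 * θ) ^ (2 * k + 1) / ((2 * k + 1).factorial : ℝ) -
    ∑ n ∈ Finset.range N, (centralFactorialFirst (n + 1) (k + 1) : ℝ) *
      (cos θ * sinDividedPow (2 * n + 1) θ))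

theorem sinRemainder_zero_succ (N : ℕ) (θ : ℝ) : sinRemainder 0 (N + 1) θ = 0 := by
  simp [sinRemainder, Finset.sum_range_succ', centralFactorialFirst, sinDividedPow_zero]

theorem sinRemainder_succ_succ (k N : ℕ) (θ : ℝ) :
    sinRemainder (k + 1) (N + 1) θ =
      (2 * θ) ^ (2 * k + 1 + 1) / ((2 * k + 1 + 1).factorial : ℝ) -
        ∑ n ∈ Finset.range N,
          (centralFactorialFirst (n + 1) (k + 1) : ℝ) * sinDividedPow (2 * n + 1 + 1) θ := by
  simp [sinRemainder, Finset.sum_range_succ', centralFactorialFirst_zero_succ, mul_add_one]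

theorem sinRemainder_succ_succ_apply_zero (k N : ℕ) : sinRemainder (k + 1) (N + 1) 0 = 0 := by
  simp [sinRemainder_succ_succ, sinDividedPow_succ_apply_zero]

theorem sinRemainderDeriv_apply_zero (k N : ℕ) : sinRemainderDeriv k N 0 = 0 := by
  simp [sinRemainderDeriv, sinDividedPow_succ_apply_zero]

theorem hasDerivAt_sinRemainder (k N : ℕ) (θ : ℝ) :
    HasDerivAt (sinRemainder (k + 1) (N + 1)) (sinRemainderDeriv k N θ) θ := by
  rw [funext (sinRemainder_succ_succ k N)]
  have hpow := hasDerivAt_pow_succ_div_factorial (hasDerivAt_const_mul (x := θ) 2) (2 * k + 1)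
  have hsum := HasDerivAt.fun_sum (u := Finset.range N) fun n _ =>
    (hasDerivAt_sinDividedPow_succ (2 * n + 1) θ).const_mul
      (centralFactorialFirst (n + 1) (k + 1) : ℝ)
  refine (hpow.sub hsum).congr_deriv ?_
  simp only [sinRemainderDeriv, mul_left_comm _ (2 : ℝ), ← Finset.mul_sum]
  ring

theorem hasDerivAt_sinRemainderDeriv (k N : ℕ) (θ : ℝ) :
    HasDerivAt (sinRemainderDeriv k N)
      (4 * (sinRemainder k N θ +
        (N : ℝ) ^ 2 * ((centralFactorialFirst N (k + 1) : ℝ) * sinDividedPow (2 * N) θ))) θ := by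
  have hpow := hasDerivAt_pow_succ_div_factorial (hasDerivAt_const_mul (x := θ) 2) (2 * k)
  have hsum := HasDerivAt.fun_sum (u := Finset.range N) fun n _ =>
    (hasDerivAt_cos_mul_sinDividedPow_succ (2 * n) θ).const_mul
      (centralFactorialFirst (n + 1) (k + 1) : ℝ)
  refine ((hpow.sub hsum).const_mul 2).congr_deriv ?_
  have hterm (n : ℕ) : 2 * sinDividedPow (2 * n) θ -
      (((2 * n : ℕ) : ℝ) + 2) ^ 2 / 2 * sinDividedPow (2 * n + 2) θ =
        2 * (sinDividedPow (2 * n) θ - ((n : ℝ) + 1) ^ 2 * sinDividedPow (2 * (n + 1)) θ) := by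
    push_cast
    ring_nf
  simp only [hterm, mul_left_comm _ (2 : ℝ), ← Finset.mul_sum]
  rw [sum_centralFactorialFirst_succ_mul (fun n => sinDividedPow (2 * n) θ), sinRemainder]
  ring

theorem sinRemainder_nonneg (k N : ℕ) {θ : ℝ} (hθ : 0 ≤ θ) : 0 ≤ sinRemainder k N θ := by
  induction k generalizing N θ with
  | zero =>
    cases N with
    | zero => simp [sinRemainder]
    | succ N => rw [sinRemainder_zero_succ]
  | succ k ih =>
    cases N with
    | zero =>
      rw [sinRemainder, Finset.sum_range_zero, sub_zero]
      positivity
    | succ N =>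
      have hderiv (x : ℝ) (hx : 0 ≤ x) : 0 ≤ sinRemainderDeriv k N x := by
        refine nonneg_of_hasDerivAt_nonneg (hasDerivAt_sinRemainderDeriv k N)
          (sinRemainderDeriv_apply_zero k N).ge (fun y hy => ?_) hx
        have := ih N hy
        have := sinDividedPow_two_mul_nonneg N y
        positivity
      exact nonneg_of_hasDerivAt_nonneg (hasDerivAt_sinRemainder k N)
        (sinRemainder_succ_succ_apply_zero k N).ge hderiv hθ

theorem centralFactorialFirst_mul_sinDividedPow_le (k n : ℕ) {θ : ℝ} (hθ : 0 ≤ θ) :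
    (centralFactorialFirst n k : ℝ) * sinDividedPow (2 * n) θ ≤
      (2 * θ) ^ (2 * k) / ((2 * k).factorial : ℝ) := by
  have hrem := sinRemainder_nonneg k (n + 1) hθ
  rw [sinRemainder, sub_nonneg] at hrem
  exact (Finset.single_le_sum (f := fun i => (centralFactorialFirst i k : ℝ) *
    sinDividedPow (2 * i) θ) (fun i _ => mul_nonneg (Nat.cast_nonneg _)
      (sinDividedPow_two_mul_nonneg i θ)) (Finset.self_mem_range_succ n)).trans hrem

theorem sin_sq_le_sin_sq {b θ : ℝ} (hb : b ≤ π / 2) (hθ : θ ∈ Set.Icc (-b) b) :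
    sin θ ^ 2 ≤ sin b ^ 2 := by
  refine sq_le_sq' ?_ (sin_le_sin_of_le_of_le_pi_div_two (by linarith [hθ.1]) hb hθ.2)
  rw [← sin_neg]
  exact sin_le_sin_of_le_of_le_pi_div_two (by linarith) (hθ.2.trans hb) hθ.1

/-- The bound of the terms at `π / 2` leaves a geometric factor `(sin b) ^ (2 N)` at `b`, which
absorbs `N ^ 2`. -/
theorem tendstoUniformlyOn_sq_mul_centralFactorialFirst_mul_sinDividedPow (k : ℕ) {b : ℝ}
    (hb₀ : 0 ≤ b) (hb : b < π / 2) :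
    TendstoUniformlyOn (fun (N : ℕ) θ => (N : ℝ) ^ 2 *
      ((centralFactorialFirst N k : ℝ) * sinDividedPow (2 * N) θ)) 0 atTop (Set.Icc (-b) b) := by
  set A : ℝ := (2 * (π / 2)) ^ (2 * k) / ((2 * k).factorial : ℝ)
  have hsin : sin b ^ 2 < 1 := by
    have hcos : 0 < cos b := cos_pos_of_mem_Ioo ⟨by linarith, hb⟩
    nlinarith [sin_sq_add_cos_sq b]
  have hlim : Tendsto (fun N : ℕ => A * ((N : ℝ) ^ 2 * (sin b ^ 2) ^ N)) atTop (𝓝 0) := by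
    simpa using (tendsto_pow_const_mul_const_pow_of_lt_one 2 (sq_nonneg _) hsin).const_mul A
  rw [SeminormedAddGroup.tendstoUniformlyOn_zero]
  intro ε hε
  filter_upwards [hlim.eventually_lt_const hε] with N hN θ hθ
  have hnonneg := sinDividedPow_two_mul_nonneg N θ
  rw [Real.norm_of_nonneg (by positivity)]
  have hgeom : (sin θ ^ 2) ^ N ≤ (sin b ^ 2) ^ N :=
    pow_le_pow_left₀ (sq_nonneg _) (sin_sq_le_sin_sq hb.le hθ) N
  refine lt_of_le_of_lt ?_ hN
  calc (N : ℝ) ^ 2 * ((centralFactorialFirst N k : ℝ) * sinDividedPow (2 * N) θ)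
      = (N : ℝ) ^ 2 * ((centralFactorialFirst N k : ℝ) * sinDividedPow (2 * N) (π / 2) *
          (sin θ ^ 2) ^ N) := by
        rw [sinDividedPow_two_mul_eq_mul_pow N θ, mul_assoc (centralFactorialFirst N k : ℝ)]
    _ ≤ (N : ℝ) ^ 2 * (A * (sin b ^ 2) ^ N) := by
        gcongr
        exact centralFactorialFirst_mul_sinDividedPow_le k N (by positivity)
    _ = A * ((N : ℝ) ^ 2 * (sin b ^ 2) ^ N) := mul_left_comm ..

theorem tendstoUniformlyOn_sinRemainder (k : ℕ) {b : ℝ} (hb₀ : 0 ≤ b) (hb : b < π / 2) :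
    TendstoUniformlyOn (sinRemainder k) 0 atTop (Set.Icc (-b) b) := by
  induction k with
  | zero =>
    rw [← tendstoUniformlyOn_add_atTop_iff_nat 1, SeminormedAddGroup.tendstoUniformlyOn_zero]
    simp +contextual [sinRemainder_zero_succ]
  | succ k ih =>
    have hsecond : TendstoUniformlyOn (fun (N : ℕ) θ => 4 * (sinRemainder k N θ +
        (N : ℝ) ^ 2 * ((centralFactorialFirst N (k + 1) : ℝ) * sinDividedPow (2 * N) θ)))
        0 atTop (Set.Icc (-b) b) := by
      have hsum := ih.add
        (tendstoUniformlyOn_sq_mul_centralFactorialFirst_mul_sinDividedPow (k + 1) hb₀ hb)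
      simpa [Function.comp_def, Pi.zero_def] using
        (uniformContinuous_const_smul (4 : ℝ)).comp_tendstoUniformlyOn hsum
    have hmem : (0 : ℝ) ∈ Set.Icc (-b) b := ⟨neg_nonpos.mpr hb₀, hb₀⟩
    have hfirst : TendstoUniformlyOn (sinRemainderDeriv k) 0 atTop (Set.Icc (-b) b) :=
      tendstoUniformlyOn_zero_of_hasDerivWithinAt (convex_Icc ..) (Metric.isBounded_Icc ..) hmem
        (fun N x _ => (hasDerivAt_sinRemainderDeriv k N x).hasDerivWithinAt)
        (sinRemainderDeriv_apply_zero k) hsecond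
    rw [← tendstoUniformlyOn_add_atTop_iff_nat 1]
    exact tendstoUniformlyOn_zero_of_hasDerivWithinAt (convex_Icc ..) (Metric.isBounded_Icc ..)
      hmem (fun N x _ => (hasDerivAt_sinRemainder k N x).hasDerivWithinAt)
      (sinRemainder_succ_succ_apply_zero k) hfirst

end SinRemainder

section Expansions

open Real Filter Topology

theorem hasSum_centralFactorialFirst_mul_sinDividedPow (k : ℕ) {θ : ℝ} (hθ : |θ| < π / 2) :
    HasSum (fun n => (centralFactorialFirst n k : ℝ) * sinDividedPow (2 * n) θ)
      ((2 * θ) ^ (2 * k) / ((2 * k).factorial : ℝ)) := by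
  rw [hasSum_iff_tendsto_nat_of_nonneg fun n =>
    mul_nonneg (Nat.cast_nonneg _) (sinDividedPow_two_mul_nonneg n θ)]
  have hrem : Tendsto (fun N => sinRemainder k N θ) atTop (𝓝 0) :=
    (tendstoUniformlyOn_sinRemainder k (abs_nonneg θ) hθ).tendsto_at (abs_le.mp le_rfl)
  simpa [sinRemainder] using hrem.const_sub ((2 * θ) ^ (2 * k) / ((2 * k).factorial : ℝ))

theorem hasSum_stirlingQ_mul_sinDividedPow {k : ℕ} (hk : k ≠ 0) {θ : ℝ} (hθ : |θ| < π / 2) :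
    HasSum (fun m => (-1) ^ m * stirlingQ (2 * k) (2 * m) * sinDividedPow (2 * k + 2 * m) θ)
      ((2 * θ) ^ (2 * k) / ((2 * k).factorial : ℝ)) := by
  have hvanish (n : ℕ) (hn : n ∉ Set.range (k + ·)) :
      (centralFactorialFirst n k : ℝ) * sinDividedPow (2 * n) θ = 0 := by
    have hlt : n < k := by
      contrapose! hn
      exact ⟨n - k, Nat.add_sub_cancel' hn⟩
    rw [centralFactorialFirst_eq_zero_of_lt hlt, Nat.cast_zero, zero_mul]
  have hshift := ((add_right_injective k).hasSum_iff hvanish).mpr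
    (hasSum_centralFactorialFirst_mul_sinDividedPow k hθ)
  refine hshift.congr_fun fun m => ?_
  rw [stirlingQ_two_mul hk, ← mul_assoc, ← mul_pow, neg_one_mul, neg_neg, one_pow, one_mul,
    ← mul_add]
  rfl

theorem centralFactorialFirst_one_mul_sinDividedPow {m : ℕ} (hm : m ≠ 0) (θ : ℝ) :
    (centralFactorialFirst m 1 : ℝ) * sinDividedPow (2 * m) θ =
      (2 * sin θ) ^ (2 * m) / (m : ℝ) ^ 2 * (1 / ((2 * m).choose m : ℝ)) := by
  obtain ⟨n, rfl⟩ := Nat.exists_eq_add_one_of_ne_zero hm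
  rw [centralFactorialFirst_succ_one, sinDividedPow,
    Nat.cast_choose ℝ (by lia : n + 1 ≤ 2 * (n + 1)), show 2 * (n + 1) - (n + 1) = n + 1 by lia,
    Nat.factorial_succ n]
  push_cast
  field_simp

theorem hasSum_two_mul_sin_pow_div_sq_mul_choose {θ : ℝ} (hθ : |θ| < π / 2) :
    HasSum (fun m : ℕ+ => (2 * sin θ) ^ (2 * (m : ℕ)) / ((m : ℕ) : ℝ) ^ 2 *
      (1 / ((2 * (m : ℕ)).choose m : ℝ))) (2 * θ ^ 2) := by
  have hsum := hasSum_centralFactorialFirst_mul_sinDividedPow 1 hθ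
  simp only [← centralFactorialFirst_one_mul_sinDividedPow (PNat.ne_zero _)]
  refine (hasSum_pnat_iff (f := fun m =>
    (centralFactorialFirst m 1 : ℝ) * sinDividedPow (2 * m) θ)).mpr ?_
  have hvalue : 2 * θ ^ 2 + (centralFactorialFirst 0 1 : ℝ) * sinDividedPow (2 * 0) θ =
      (2 * θ) ^ (2 * 1) / ((2 * 1).factorial : ℝ) := by
    rw [centralFactorialFirst_zero_succ, mul_one, Nat.factorial_two]
    push_cast
    ring
  rwa [hvalue]

theorem abs_pi_div_four_lt : |π / 4| < π / 2 := by
  rw [abs_of_pos (by positivity)]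
  linarith [pi_pos]

theorem two_mul_sin_pi_div_four_pow (n : ℕ) : (2 * sin (π / 4)) ^ (2 * n) = 2 ^ n := by
  rw [sin_pi_div_four, mul_div_cancel₀ _ (two_ne_zero' ℝ), pow_mul, sq_sqrt zero_le_two]

theorem hasSum_stirlingQ_pi_sq_div_eight_pow {k : ℕ} (hk : k ≠ 0) :
    HasSum (fun m : ℕ+ => (-1 : ℝ) ^ (m : ℕ) * 2 ^ (m : ℕ) *
        (stirlingQ (2 * k) (2 * (m : ℕ)) / ((2 * k + 2 * (m : ℕ)).factorial : ℝ)))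
      (((π ^ 2 / 8) ^ k - 1) / ((2 * k).factorial : ℝ)) := by
  have hsum := (hasSum_stirlingQ_mul_sinDividedPow hk abs_pi_div_four_lt).div_const (2 ^ k)
  have hterm (m : ℕ) : (-1 : ℝ) ^ m * 2 ^ m *
      (stirlingQ (2 * k) (2 * m) / ((2 * k + 2 * m).factorial : ℝ)) =
      (-1) ^ m * stirlingQ (2 * k) (2 * m) * sinDividedPow (2 * k + 2 * m) (π / 4) / 2 ^ k := by
    rw [sinDividedPow, ← mul_add, two_mul_sin_pi_div_four_pow, pow_add]
    field_simp
  have hpow : (2 * (π / 4)) ^ (2 * k) = (π ^ 2 / 8) ^ k * 2 ^ k := by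
    rw [pow_mul, ← mul_pow]
    ring
  have hzero : stirlingQ (2 * k) 0 = 1 := by
    simpa [centralFactorialFirst_self] using stirlingQ_two_mul hk 0
  have hvalue : ((π ^ 2 / 8) ^ k - 1) / ((2 * k).factorial : ℝ) +
      (-1) ^ 0 * 2 ^ 0 * (stirlingQ (2 * k) (2 * 0) / ((2 * k + 2 * 0).factorial : ℝ)) =
      (2 * (π / 4)) ^ (2 * k) / ((2 * k).factorial : ℝ) / 2 ^ k := by
    simp only [hpow, hzero, mul_zero, pow_zero, add_zero]
    field_simp
    ring
  refine (hasSum_pnat_iff (f := fun m : ℕ => (-1 : ℝ) ^ m * 2 ^ m *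
    (stirlingQ (2 * k) (2 * m) / ((2 * k + 2 * m).factorial : ℝ)))).mpr ?_
  rw [hvalue]
  exact hsum.congr_fun hterm

end Expansions

theorem corollary4p2 :
    (∀ k : ℕ, 1 ≤ k →
      Summable (fun m : ℕ+ => (-1 : ℝ) ^ (m : ℕ) * 2 ^ (m : ℕ) *
        (stirlingQ (2 * k) (2 * (m : ℕ)) / (Nat.factorial (2 * k + 2 * (m : ℕ)) : ℝ))) ∧
      (Real.pi ^ 2 / 8) ^ k =
        1 + (Nat.factorial (2 * k) : ℝ) *
          ∑' m : ℕ+, (-1 : ℝ) ^ (m : ℕ) * 2 ^ (m : ℕ) *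
            (stirlingQ (2 * k) (2 * (m : ℕ)) / (Nat.factorial (2 * k + 2 * (m : ℕ)) : ℝ))) ∧
    Summable (fun m : ℕ+ => (2 : ℝ) ^ (m : ℕ) / ((m : ℕ) : ℝ) ^ 2 *
      (1 / (Nat.choose (2 * (m : ℕ)) (m : ℕ) : ℝ))) ∧
    Real.pi ^ 2 / 8 =
      ∑' m : ℕ+, (2 : ℝ) ^ (m : ℕ) / ((m : ℕ) : ℝ) ^ 2 *
        (1 / (Nat.choose (2 * (m : ℕ)) (m : ℕ) : ℝ)) := by
  refine ⟨fun k hk => ?_, ?_⟩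
  · have hsum := hasSum_stirlingQ_pi_sq_div_eight_pow (Nat.one_le_iff_ne_zero.mp hk)
    refine ⟨hsum.summable, ?_⟩
    rw [hsum.tsum_eq, mul_div_cancel₀ _ (by positivity), add_sub_cancel]
  · have hsum := hasSum_two_mul_sin_pow_div_sq_mul_choose abs_pi_div_four_lt
    simp only [two_mul_sin_pi_div_four_pow] at hsum
    have hpi : 2 * (Real.pi / 4) ^ 2 = Real.pi ^ 2 / 8 := by ring
    rw [hpi] at hsum
    exact ⟨hsum.summable, hsum.tsum_eq.symm⟩
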